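/- Let $W:\mathbb{R}\to\mathbb{C}$ be a weight function, not necessarily nonnegative, such that $e^{cx}W(x)$ is integrable over $\mathbb{R}$ for every $c\in\mathbb{R}$, and let $M_j=\int_{\mathbb{R}}x^jW(x)\,dx$ ($j\ge 0$) be its moments. Let $\hat C_0,\hat C_1,\hat C_2,\dots$ be nonzero constants (normalizations). Let $\mathbf{t}=(t_1,t_2,\dots)$ be a sequence of variables. For a sequence $\mathbf{u}=(u_1,u_2,\dots)$ with entries in $\mathbb{C}[[t_1,t_2,\dots]]$ define $h_j(\mathbf{u})$, $j\in\mathbb{Z}$, by $\sum_{j}h_j(\mathbf{u})w^j=\exp\big(\sum_{k\ge 1}u_kw^k\big)$ (so $h_j=0$ for $j<0$), and $$\hat Z_d(\mathbf{u})=\frac{1}{d!\,\hat C_d}\sum_{j_1,\dots,j_d=0}^{\infty}\frac{\det\big[M_{j_p+q-1}\big]_{p,q=1}^d\,\det\big[h_{j_p-d+q}(\mathbf{u})\big]_{p,q=1}^d}{\prod_{k=1}^d j_k!},$$ the sum being taken coefficient by coefficient in $\mathbb{C}[[t_1,t_2,\dots]]$. For $c\in\mathbb{C}$ put $[c]=(c,c^2/2,c^3/3,\dots)$,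 and put $\Delta_m(a_1,\dots,a_m)=\prod_{1\le j<k\le m}(a_j-a_k)$. Then: (i) For all integers $n,r\ge 0$ and all $b_1,\dots,b_r\in\mathbb{C}$, the series defining $\hat Z_n(\mathbf{t}+[b_1]+\cdots+[b_r])$ converges unconditionally in every coefficient, and every coefficient of its sum is a continuous function of $(b_1,\dots,b_r)\in\mathbb{C}^r$. (ii) If $W$ is real-valued, nonnegative and not almost everywhere zero, then $\hat Z_n(\mathbf{t})\neq 0$ for all $n\ge 0$. (iii) For any $d\ge m\ge 1$ such that the formal power series $\hat Z_n(\mathbf{t})$, $d+1-m\le n\le d$, are nonzero, and for any pairwise distinct $a_1,\dots,a_m\in\mathbb{C}$, $$\frac{\hat Z_d(\mathbf{t}+[a_1]+\cdots+[a_m])}{\hat Z_d(\mathbf{t})}=\frac{1}{\Delta_m(a_1,\dots,a_m)}\det\left[a_k^{m-j}\,\frac{\hat Z_{d+1-j}(\mathbf{t}+[a_k])}{\hat Z_{d+1-j}(\mathbf{t})}\right]_{j,k=1}^m$$ in the field of fractions of $\mathbb{C}[[t_1,t_2,\dots]]$. (By the continuity in (i), when some of the $a_k$ coincide the identity holds with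 the right-hand side read as a limit.) -/

import Mathlib

open MeasureTheory
open scoped MvPowerSeries.WithPiTopology

noncomputable section

/-- The ring `ℂ⟦t₁, t₂, …⟧` of formal power series in the variables `t = (t₁, t₂, …)`. The topology
used on it is that of coefficientwise convergence (with the usual topology of `ℂ`). -/
abbrev TSeries : Type := MvPowerSeries ℕ+ ℂ

/-- The sequence of variables `t = (t₁, t₂, …)`. -/
def tvar : ℕ+ → TSeries := fun k => MvPowerSeries.X k

/-- The constant sequence `[c] = (c, c²/2, c³/3, …)`. -/
def bracket (c : ℂ) : ℕ+ → TSeries := fun k => MvPowerSeries.C (c ^ (k : ℕ) / ((k : ℕ) : ℂ))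

/-- The series `∑_{k ≥ 1} u_k w^k` in one further variable `w`. -/
def timeSeries (u : ℕ+ → TSeries) : PowerSeries TSeries :=
  PowerSeries.mk fun k => if hk : 0 < k then u ⟨k, hk⟩ else 0

/-- The series `∑_{k ≥ 1} u_k w^k` has no constant term, so it may be substituted into `exp`. -/
theorem hasSubst_timeSeries (u : ℕ+ → TSeries) : PowerSeries.HasSubst (timeSeries u) :=
  PowerSeries.HasSubst.of_constantCoeff_zero' (by simp [timeSeries])

/-- The elementary Schur functions `h_j(u)`, `j ∈ ℤ`, of a sequence `u = (u₁, u₂, …)`: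
`∑_j h_j(u) w^j = exp (∑_{k ≥ 1} u_k w^k)`, with `h_j(u) = 0` for `j < 0`. -/
def hSchur (u : ℕ+ → TSeries) (j : ℤ) : TSeries :=
  if 0 ≤ j then
    PowerSeries.coeff j.toNat ((PowerSeries.exp ℂ).subst (timeSeries u) : PowerSeries TSeries)
  else 0

/-- The moments `M_j = ∫ x^j W(x) dx` of the weight `W`. -/
def moment (W : ℝ → ℂ) (j : ℕ) : ℂ := ∫ x : ℝ, (x : ℂ) ^ j * W x

/-- The summand
`det[M_{j_p+q-1}]_{p,q=1}^d · det[h_{j_p-d+q}(u)]_{p,q=1}^d / ∏_p j_p!`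
(the indices `p`, `q` run through `0, …, d - 1` in the code). -/
def zhatTerm (W : ℝ → ℂ) (d : ℕ) (u : ℕ+ → TSeries) (j : Fin d → ℕ) : TSeries :=
  ((Matrix.of fun p q : Fin d => moment W (j p + (q : ℕ))).det
      / ∏ p : Fin d, ((j p).factorial : ℂ)) •
    (Matrix.of fun p q : Fin d => hSchur u ((j p : ℤ) - (d : ℤ) + ((q : ℕ) : ℤ) + 1)).det

/-- `Ẑ_d(u) = 1 / (d! Ĉ_d) · ∑_{j₁, …, j_d ≥ 0} det[M_{j_p+q-1}] det[h_{j_p-d+q}(u)] / ∏_p j_p!`,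
the sum being taken coefficientwise in `ℂ⟦t₁, t₂, …⟧`. -/
def Zhat (W : ℝ → ℂ) (Chat : ℕ → ℂ) (d : ℕ) (u : ℕ+ → TSeries) : TSeries :=
  (1 / ((d.factorial : ℂ) * Chat d)) • ∑' j : Fin d → ℕ, zhatTerm W d u j

/-- The field of fractions of `ℂ⟦t₁, t₂, …⟧`. -/
abbrev TField : Type := FractionRing TSeries

/-- The ratio `f / g` of two formal power series, in the field of fractions. -/
def ratio (f g : TSeries) : TField := algebraMap TSeries TField f / algebraMap TSeries TField g

/-- `Δ_m(a₁, …, a_m) = ∏_{j < k} (a_j - a_k)`. -/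
def vdm {m : ℕ} (a : Fin m → ℂ) : ℂ :=
  ∏ j : Fin m, ∏ k ∈ Finset.Ioi j, (a j - a k)

end

/-! ### Linear algebra over a field: columns linked by a one-step recursion. -/

section Core
open Polynomial Matrix

variable {K : Type*} [Field K]

/-! Expanding both determinants and summing over each `j_p` separately (Andréief's identity) turns
the multiple series into a single determinant: up to a nonzero constant, `Zhat` of size `d` is
`det[E_{l,p}(u)]` with `E_{l,p}(u) = ∑_j M_{j+p}/j! · h_{j-l}(u)`. Adding `[c]` to `u` multiplies `∑
h_j w^j` by `1/(1 - cw)`, so the columns obey `E_l(u+[c]) = E_l(u) + c E_{l+1}(u+[c])`. The formula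
then follows from this recursion alone.

Let `N = d - m` and let `Q` have columns `E_l(t)` for `l < N`, followed by `E_N(t+[a_k])` for `k <
m`. Its determinant is computed twice. In terms of the columns at `t + ∑[a_i]`, it is their
determinant times a Vandermonde factor (`det_mul_lagrange`). In terms of the columns at `t`, it is
their determinant times an `m × m` determinant of Cramer quotients (`det_functionals`), and each
quotient is a power of `a_k` times a one-point ratio (`pow_mul_det_leadingBlock`).

Convergence and continuity hold because `M_{j+p}/j!` decays faster than every geometric sequence,
while each coefficient of `h_j` grows at most geometrically, locally uniformly in the `b_i`. For
nonnegative `W`, the constant term of `det[E_{l,p}(t)]` is a Hankel determinant of moments divided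
by factorials, hence nonzero. -/

theorem det_lagrange_coeff {m : ℕ} (a : Fin m → K) (ha : Function.Injective a) :
    (Matrix.of fun j k : Fin m =>
      (∏ i ∈ Finset.univ.erase k, (X - C (a i))).coeff (j : ℕ)).det
      = ∏ j : Fin m, ∏ k ∈ Finset.Ioi j, (a j - a k) := by
  classical
  set V : Matrix (Fin m) (Fin m) K := Matrix.of fun j k : Fin m =>
      (∏ i ∈ Finset.univ.erase k, (X - C (a i))).coeff (j : ℕ) with hV
  -- Multiplying by the Vandermonde matrix evaluates the column polynomials at the nodes; the `k`-th
  -- vanishes at every node except `a k`.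
  have hmul : Matrix.vandermonde a * V =
      Matrix.diagonal fun k => ∏ i ∈ Finset.univ.erase k, (a k - a i) := by
    ext i k
    have hdeg : (∏ i ∈ Finset.univ.erase k, (X - C (a i))).natDegree < m := by
      rw [Polynomial.natDegree_prod_of_monic _ _ fun i _ => monic_X_sub_C _]
      have := k.pos
      simp [Finset.card_erase_of_mem]
      omega
    have h1 : (Matrix.vandermonde a * V) i k =
        (∏ i ∈ Finset.univ.erase k, (X - C (a i))).eval (a i) := by
      rw [Polynomial.eval_eq_sum_range' hdeg, Finset.sum_range, Matrix.mul_apply]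
      exact Finset.sum_congr rfl fun j _ => by simp [hV, Matrix.vandermonde_apply, mul_comm]
    rw [h1, Polynomial.eval_prod]
    simp only [eval_sub, eval_X, eval_C]
    by_cases hik : i = k
    · subst hik; simp
    · rw [Matrix.diagonal_apply_ne _ hik]
      exact Finset.prod_eq_zero (Finset.mem_erase.2 ⟨hik, Finset.mem_univ i⟩) (sub_self _)
  have hdet := congrArg Matrix.det hmul
  rw [Matrix.det_mul, Matrix.det_vandermonde, Matrix.det_diagonal] at hdet
  have hne : (∏ i : Fin m, ∏ j ∈ Finset.Ioi i, (a j - a i)) ≠ 0 := by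
    refine Finset.prod_ne_zero_iff.2 fun i _ => Finset.prod_ne_zero_iff.2 fun j hj => ?_
    exact sub_ne_zero.2 fun h => (Finset.mem_Ioi.1 hj).ne' (ha h)
  apply mul_left_cancel₀ hne
  rw [hdet, ← Finset.prod_mul_distrib]
  simp_rw [← Finset.prod_mul_distrib]
  have := Finset.prod_prod_Ioi_mul_eq_prod_prod_off_diag fun i j : Fin m => a j - a i
  simp only [Finset.compl_singleton] at this
  rw [← this]
  exact Finset.prod_congr rfl fun i _ => Finset.prod_congr rfl fun j _ => mul_comm _ _

theorem coeff_prod_one_sub {ι : Type*} (s : Finset ι) (a : ι → K) (i j : ℕ) (h : i + j = s.card) :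
    (∏ i ∈ s, (1 - C (a i) * X)).coeff i = (∏ i ∈ s, (X - C (a i))).coeff j := by
  have hrev : (∏ i ∈ s, (X - C (a i))).reverse = ∏ i ∈ s, (1 - C (a i) * X) := by
    classical
    induction s using Finset.induction_on generalizing i j with
    | empty => simpa using reverse_C (1 : K)
    | insert k s hk ih =>
      rw [Finset.prod_insert hk, Finset.prod_insert hk, reverse_mul_of_domain,
        ih 0 s.card (by simp)]
      congr 1
      rw [reverse, natDegree_X_sub_C, reflect_sub, reflect_C, ← pow_one X, reflect_monomial]
      simp
  rw [← hrev, coeff_reverse, Polynomial.natDegree_prod_of_monic _ _ fun i _ => monic_X_sub_C _]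
  simp only [natDegree_X_sub_C, Finset.sum_const, smul_eq_mul, mul_one, ← h]
  rw [revAt_le (by omega)]
  congr 1; omega

/-- The index shift on sequences. -/
def shiftSeq (K : Type*) [Field K] : Module.End K (ℕ → K) where
  toFun f := fun l => f (l + 1)
  map_add' _ _ := rfl
  map_smul' _ _ := rfl

theorem shiftSeq_pow_apply (s l : ℕ) (f : ℕ → K) : (shiftSeq K ^ s) f l = f (l + s) := by
  induction s generalizing l with
  | zero => rfl
  | succ s ih =>
    rw [pow_succ', Module.End.mul_apply]
    change (shiftSeq K ^ s) f (l + 1) = _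
    rw [ih]; congr 1; ring

theorem aeval_shiftSeq_apply {P : K[X]} {n : ℕ} (hP : P.natDegree < n) (f : ℕ → K) (l : ℕ) :
    aeval (shiftSeq K) P f l = ∑ s ∈ Finset.range n, P.coeff s * f (l + s) := by
  rw [Polynomial.aeval_eq_sum_range' hP]
  simp [LinearMap.sum_apply, Finset.sum_apply, shiftSeq_pow_apply]

variable {ι : Type*} [DecidableEq ι] (a : ι → K) (c : Finset ι → ℕ → K)

/-- The recursion says that `1 - a i · shift` removes `i` from the index set, so the product over
`T` removes all of `T`. -/
theorem aeval_shiftSeq_union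
    (hc : ∀ S i, i ∉ S → ∀ l, c (insert i S) l = c S l + a i * c (insert i S) (l + 1))
    (S T : Finset ι) (h : Disjoint T S) :
    aeval (shiftSeq K) (∏ i ∈ T, (1 - C (a i) * X)) (c (T ∪ S)) = c S := by
  induction T using Finset.induction_on with
  | empty => simp
  | insert i T hi ih =>
    rw [Finset.disjoint_insert_left] at h
    rw [Finset.prod_insert hi, mul_comm, map_mul, Module.End.mul_apply]
    conv_rhs => rw [← ih h.2]
    congr 1
    funext l
    rw [Finset.insert_union]
    have := hc (T ∪ S) i (by simp [hi, h.1]) l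
    have h2 : (aeval (shiftSeq K)) (1 - C (a i) * X) (c (insert i (T ∪ S))) l
       = c (insert i (T ∪ S)) l - a i * c (insert i (T ∪ S)) (l + 1) := by
      simp [shiftSeq]
    rw [h2, this]; ring

theorem sum_coeff_mul_X_pow {P : K[X]} {n : ℕ} (l : ℕ) (hP : P.natDegree + l < n) (f : ℕ → K) :
    ∑ r : Fin n, f r * (P * X ^ l).coeff (r : ℕ) = aeval (shiftSeq K) P f l := by
  have h1 : aeval (shiftSeq K) (P * X ^ l) f 0 = aeval (shiftSeq K) P f l := by
    rw [mul_comm, map_mul, Module.End.mul_apply, aeval_X_pow, shiftSeq_pow_apply, zero_add]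
  rw [← h1, aeval_shiftSeq_apply (n := n), Finset.sum_range]
  · simp [mul_comm]
  · exact (natDegree_mul_le.trans (by simp)).trans_lt hP

theorem natDegree_prod_one_sub_le {ι : Type*} (a : ι → K) (T : Finset ι) :
    (∏ i ∈ T, (1 - C (a i) * X)).natDegree ≤ T.card := by
  refine (natDegree_prod_le _ _).trans ?_
  refine (Finset.sum_le_card_nsmul _ _ 1 fun i _ => ?_).trans (by simp)
  compute_degree

/-- The leading `n × n` block of the matrix with columns `e 0, e 1, …`. -/
def leadingBlock (e : ℕ → ℕ → K) (n : ℕ) : Matrix (Fin n) (Fin n) K :=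
  Matrix.of fun p l => e l p

/-- Subtracting `a` times the next column turns `e'` into `e` everywhere except in the last column,
which has no successor in the block. -/
theorem det_leadingBlock_step {e e' : ℕ → ℕ → K} {a : K}
    (h : ∀ l p, e' l p = e l p + a * e' (l + 1) p) (n : ℕ) :
    (leadingBlock e' (n + 1)).det
      = (leadingBlock e (n + 1)).cramer (fun p => e' n p) (Fin.last n) := by
  -- The columns are reversed so that "next" becomes "previous", as the column-operation lemma
  -- requires.
  rw [Matrix.cramer_apply, ← Matrix.det_submatrix_equiv_self Fin.revPerm (leadingBlock e' (n + 1)),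
    ← Matrix.det_submatrix_equiv_self Fin.revPerm (Matrix.updateCol _ _ _)]
  refine Matrix.det_eq_of_forall_col_eq_smul_add_pred (fun _ => a) (fun i => ?_) fun i j => ?_
  · simp [leadingBlock]
  · have hj : (Fin.rev j.succ : Fin (n + 1)) ≠ Fin.last n := by
      simp [Fin.ext_iff, Fin.val_rev]; omega
    simp only [Matrix.submatrix_apply, Fin.revPerm_apply, Matrix.updateCol_ne hj, leadingBlock,
      Matrix.of_apply]
    rw [h]
    congr 3
    simp [Fin.val_rev]; omega

theorem cramer_leadingBlock_col (e : ℕ → ℕ → K) {n l : ℕ} (hl : l < n) (i : Fin n) :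
    (leadingBlock e n).cramer (fun p => e l p) i
      = if l = i then (leadingBlock e n).det else 0 := by
  rw [Matrix.cramer_row_self (leadingBlock e n) (fun p => e l p) (⟨l, hl⟩ : Fin n) fun j => rfl,
    Pi.single_apply]
  simp [Fin.ext_iff, eq_comm]

theorem expand_step {e e' : ℕ → ℕ → K} {a : K}
    (h : ∀ l p, e' l p = e l p + a * e' (l + 1) p) (N s p : ℕ) :
    e' N p = ∑ i ∈ Finset.range s, a ^ i * e (N + i) p + a ^ s * e' (N + s) p := by
  induction s with
  | zero => simp
  | succ s ih => rw [ih, Finset.sum_range_succ, h (N + s), add_assoc N s 1]; ring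

/-- Iterating the recursion `s` times writes `e' N` as a combination of `e N, …, e (N+s-1)` plus
`a^s e' (N+s)`. The former are columns of the block other than the last, so the last Cramer
coordinate kills them. -/
theorem pow_mul_det_leadingBlock {e e' : ℕ → ℕ → K} {a : K}
    (h : ∀ l p, e' l p = e l p + a * e' (l + 1) p) (N s : ℕ) :
    a ^ s * (leadingBlock e' (N + s + 1)).det
      = (leadingBlock e (N + s + 1)).cramer (fun p => e' N p) (Fin.last (N + s)) := by
  have h1 : (fun p : Fin (N + s + 1) => e' N p) =
      ∑ i ∈ Finset.range s, a ^ i • (fun p : Fin (N + s + 1) => e (N + i) p)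
        + a ^ s • fun p : Fin (N + s + 1) => e' (N + s) p := by
    funext p
    simp [expand_step h N s p]
  rw [h1, map_add, map_sum, Pi.add_apply, Finset.sum_apply, Finset.sum_eq_zero, zero_add, map_smul,
    det_leadingBlock_step h, Pi.smul_apply, smul_eq_mul]
  intro i hi
  have := Finset.mem_range.1 hi
  rw [map_smul, Pi.smul_apply, cramer_leadingBlock_col e (by omega), if_neg, smul_zero]
  simp; omega

variable {m : ℕ} (N : ℕ)

/-- The position in `ℕ` of an index of the block decomposition `N + m`. -/
def blockIdx {m : ℕ} (N : ℕ) (x : Fin N ⊕ Fin m) : ℕ := (finSumFinEquiv x : Fin (N + m))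

theorem det_leadingBlock_blockIdx (e : ℕ → ℕ → K) :
    (Matrix.of fun p l : Fin N ⊕ Fin m => e (blockIdx N l) (blockIdx N p)).det
      = (leadingBlock e (N + m)).det :=
  Matrix.det_submatrix_equiv_self finSumFinEquiv (leadingBlock e (N + m))

@[simp] theorem blockIdx_inl (l : Fin N) : blockIdx N (Sum.inl l : Fin N ⊕ Fin m) = l := rfl
@[simp] theorem blockIdx_inr (k : Fin m) : blockIdx N (Sum.inr k : Fin N ⊕ Fin m) = N + k := rfl

theorem sum_blockIdx (g : ℕ → K) :
    ∑ x : Fin N ⊕ Fin m, g (blockIdx N x) = ∑ r : Fin (N + m), g r :=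
  Equiv.sum_comp finSumFinEquiv fun r : Fin (N + m) => g r

/-- Each column on the left is a polynomial in the shift applied to the columns of `c univ`: `∏(1 -
a_i X)·X^l` gives `c ∅ l`, and omitting the factor `k` gives `c {k} N`. The coefficient matrix `T`
is block lower triangular with a unitriangular first block. -/
theorem det_mul_lagrange (a : Fin m → K)
    (c : Finset (Fin m) → ℕ → ℕ → K)
    (hc : ∀ S i, i ∉ S → ∀ l p, c (insert i S) l p = c S l p + a i * c (insert i S) (l + 1) p) :
    (Matrix.of fun p (x : Fin N ⊕ Fin m) =>
        Sum.elim (fun l : Fin N => c ∅ l (blockIdx N p)) (fun k => c {k} N (blockIdx N p)) x).det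
      = (leadingBlock (c Finset.univ) (N + m)).det *
        (Matrix.of fun s k : Fin m =>
          (∏ i ∈ Finset.univ.erase k, (1 - C (a i) * X)).coeff (s : ℕ)).det := by
  set T : Matrix (Fin N ⊕ Fin m) (Fin N ⊕ Fin m) K := Matrix.of fun r x =>
    (Sum.elim (fun l : Fin N => (∏ i, (1 - C (a i) * X)) * X ^ (l : ℕ))
      (fun k => (∏ i ∈ Finset.univ.erase k, (1 - C (a i) * X)) * X ^ N) x).coeff (blockIdx N r)
    with hT
  have hdetT : T.det = (Matrix.of fun s k : Fin m =>
          (∏ i ∈ Finset.univ.erase k, (1 - C (a i) * X)).coeff (s : ℕ)).det := by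
    have h12 : T.toBlocks₁₂ = 0 := by
      ext r k
      have := r.2
      simp [hT, Matrix.toBlocks₁₂, coeff_mul_X_pow']
    rw [← Matrix.fromBlocks_toBlocks T, h12, Matrix.det_fromBlocks_zero₁₂,
      Matrix.det_of_isLowerTriangular]
    · rw [Finset.prod_eq_one, one_mul]
      · congr 1
        ext s k
        simp [hT, Matrix.toBlocks₂₂, coeff_mul_X_pow']
      · intro l _
        simp [hT, Matrix.toBlocks₁₁, coeff_mul_X_pow', coeff_zero_eq_eval_zero, eval_prod]
    · intro r l hrl
      have : (r : ℕ) < l := hrl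
      simp [hT, Matrix.toBlocks₁₁, coeff_mul_X_pow', Fin.lt_def.2 this]
  rw [← hdetT, ← det_leadingBlock_blockIdx, ← Matrix.det_mul]
  congr 1
  ext p x
  rw [Matrix.mul_apply]
  have hc' := fun S i hi l => hc S i hi l (blockIdx N p)
  have hU := aeval_shiftSeq_union a (fun S l => c S l (blockIdx N p)) hc'
  rcases x with l | k
  · simp only [hT, Matrix.of_apply, Sum.elim_inl]
    rw [sum_blockIdx N fun r => c Finset.univ r (blockIdx N p) *
      ((∏ i, (1 - C (a i) * X)) * X ^ (l : ℕ)).coeff r,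
      sum_coeff_mul_X_pow (l : ℕ) _ fun r => c Finset.univ r (blockIdx N p)]
    · have := congrFun (hU ∅ Finset.univ (by simp)) l
      simpa using this.symm
    -- The degree is at most `m + l < N + m`, so the block of size `N + m` loses no coefficient.
    · have := natDegree_prod_one_sub_le a Finset.univ
      simp only [Finset.card_univ, Fintype.card_fin] at this
      omega
  · simp only [hT, Matrix.of_apply, Sum.elim_inr]
    rw [sum_blockIdx N fun r => c Finset.univ r (blockIdx N p) *
      ((∏ i ∈ Finset.univ.erase k, (1 - C (a i) * X)) * X ^ N).coeff r,
      sum_coeff_mul_X_pow N _ fun r => c Finset.univ r (blockIdx N p)]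
    · have := congrFun (hU {k} (Finset.univ.erase k) (by simp)) N
      have huniv : Finset.univ.erase k ∪ {k} = Finset.univ := by
        ext i; simp
      rw [huniv] at this
      exact this.symm
    · have := natDegree_prod_one_sub_le a (Finset.univ.erase k)
      rw [Finset.card_erase_of_mem (Finset.mem_univ k), Finset.card_univ, Fintype.card_fin] at this
      have := k.pos
      omega

/-- The determinant of the last `m` coordinates of the `v k`, in the basis of columns of `c0`, does
not change if coordinate `N+s` is replaced by the Cramer quotient of the block of size `N+s+1`. That
quotient kills the columns before `N+s` and is 1 on column `N+s`, so the change is by the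
unitriangular matrix `U`. -/
theorem det_functionals (c0 : ℕ → ℕ → K) (v : Fin m → ℕ → K)
    (h0 : ∀ n, N + 1 ≤ n → n ≤ N + m → (leadingBlock c0 n).det ≠ 0) (hm : 0 < m) :
    (Matrix.of fun p (x : Fin N ⊕ Fin m) =>
        Sum.elim (fun l : Fin N => c0 l (blockIdx N p)) (fun k => v k (blockIdx N p)) x).det
      = (leadingBlock c0 (N + m)).det *
        (Matrix.of fun s k : Fin m =>
          (leadingBlock c0 (N + s + 1)).cramer (fun p => v k p) (Fin.last (N + s))
            / (leadingBlock c0 (N + s + 1)).det).det := by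
  set B : Matrix (Fin N ⊕ Fin m) (Fin N ⊕ Fin m) K :=
    Matrix.of fun p l => c0 (blockIdx N l) (blockIdx N p) with hB
  have hBdet : B.det = (leadingBlock c0 (N + m)).det := det_leadingBlock_blockIdx N c0
  have hBu : IsUnit B.det := by
    rw [hBdet]; exact (h0 _ (by omega) le_rfl).isUnit
  set V : Matrix (Fin N ⊕ Fin m) (Fin m) K := Matrix.of fun p k => v k (blockIdx N p) with hV
  set Y : Matrix (Fin N ⊕ Fin m) (Fin m) K := B⁻¹ * V with hY
  have hBY : B * Y = V := by rw [hY, Matrix.mul_nonsing_inv_cancel_left _ _ hBu]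
  have hQ : (Matrix.of fun p (x : Fin N ⊕ Fin m) =>
      Sum.elim (fun l : Fin N => c0 l (blockIdx N p)) (fun k => v k (blockIdx N p)) x)
      = B * Matrix.fromBlocks 1 (Y.submatrix Sum.inl id) 0 (Y.submatrix Sum.inr id) := by
    ext p x
    rcases x with l | k
    · simp [Matrix.mul_apply, Matrix.one_apply, hB]
    · have := congrFun (congrFun hBY p) k
      simp only [Matrix.mul_apply, Fintype.sum_sum_type] at this
      simp [Matrix.mul_apply, this, hV]
  rw [hQ, Matrix.det_mul, Matrix.det_fromBlocks_zero₂₁, Matrix.det_one, one_mul, hBdet]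
  congr 1
  set U : Matrix (Fin m) (Fin m) K := Matrix.of fun s s' =>
    (leadingBlock c0 (N + s + 1)).cramer (fun p => c0 (N + s') p) (Fin.last (N + s))
            / (leadingBlock c0 (N + s + 1)).det with hU
  have hUdet : U.det = 1 := by
    rw [Matrix.det_of_isUpperTriangular]
    · refine Finset.prod_eq_one fun s _ => ?_
      have := s.2
      rw [hU, Matrix.of_apply, cramer_leadingBlock_col c0 (by omega)]
      simp [h0 (N + s + 1) (by omega) (by omega)]
    · intro s s' hs
      have hs : (s' : ℕ) < s := hs
      rw [hU, Matrix.of_apply, cramer_leadingBlock_col c0 (by omega), if_neg, zero_div]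
      simp; omega
  have hL : (Matrix.of fun s k : Fin m =>
          (leadingBlock c0 (N + s + 1)).cramer (fun p => v k p) (Fin.last (N + s))
            / (leadingBlock c0 (N + s + 1)).det) = U * Y.submatrix Sum.inr id := by
    ext s k
    have hs := s.2
    have hv : (fun p : Fin (N + s + 1) => v k p) =
        ∑ x : Fin N ⊕ Fin m, Y x k • fun p : Fin (N + s + 1) => c0 (blockIdx N x) p := by
      funext p
      have hp := p.2
      have := congrFun (congrFun hBY (finSumFinEquiv.symm ⟨p, by omega⟩)) k
      rw [Matrix.mul_apply] at this
      have hp' : blockIdx N (finSumFinEquiv.symm (⟨p, by omega⟩ : Fin (N + m))) = p := by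
        simp [blockIdx]
      simp only [hB, hV, Matrix.of_apply, hp'] at this
      rw [← this, Finset.sum_apply]
      exact Finset.sum_congr rfl fun x _ => by simp [mul_comm]
    rw [Matrix.of_apply, hv, map_sum, Finset.sum_apply, Fintype.sum_sum_type, Finset.sum_eq_zero,
      zero_add, Matrix.mul_apply, Finset.sum_div]
    · refine Finset.sum_congr rfl fun s' _ => ?_
      simp only [hU, map_smul, Pi.smul_apply, Matrix.of_apply, blockIdx_inr, smul_eq_mul,
        Matrix.submatrix_apply, id]
      ring
    · intro l _
      have := l.2
      rw [map_smul, Pi.smul_apply, blockIdx_inl, cramer_leadingBlock_col c0 (by omega), if_neg,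
        smul_zero]
      simp; omega
  rw [hL, Matrix.det_mul, hUdet, one_mul]

/-- The determinantal formula for a family of columns with the recursion
`c (S ∪ {i}) l = c S l + a i * c (S ∪ {i}) (l + 1)`. -/
theorem det_leadingBlock_ratio (hm : 0 < m) (a : Fin m → K) (ha : Function.Injective a)
    (c : Finset (Fin m) → ℕ → ℕ → K)
    (hc : ∀ S i, i ∉ S → ∀ l p, c (insert i S) l p = c S l p + a i * c (insert i S) (l + 1) p)
    (h0 : ∀ n, N + 1 ≤ n → n ≤ N + m → (leadingBlock (c ∅) n).det ≠ 0) :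
    (leadingBlock (c Finset.univ) (N + m)).det / (leadingBlock (c ∅) (N + m)).det
      = 1 / (∏ j : Fin m, ∏ k ∈ Finset.Ioi j, (a j - a k)) *
        (Matrix.of fun j k : Fin m => a k ^ (m - 1 - (j : ℕ)) *
          ((leadingBlock (c {k}) (N + m - j)).det / (leadingBlock (c ∅) (N + m - j)).det)).det := by
  have h1 := det_mul_lagrange N a c hc
  rw [det_functionals N (c ∅) (fun k => c {k} N) h0 hm] at h1
  have h2 : (Matrix.of fun s k : Fin m =>
          (leadingBlock (c ∅) (N + s + 1)).cramer (fun p => c {k} N p) (Fin.last (N + s))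
            / (leadingBlock (c ∅) (N + s + 1)).det) =
      (Matrix.of fun j k : Fin m => a k ^ (m - 1 - (j : ℕ)) *
        ((leadingBlock (c {k}) (N + m - j)).det
          / (leadingBlock (c ∅) (N + m - j)).det)).submatrix Fin.revPerm id := by
    ext s k
    have hs := s.2
    have hk : ∀ l p, c {k} l p = c ∅ l p + a k * c {k} (l + 1) p := fun l p => by
      simpa using hc ∅ k (by simp) l p
    have e1 : N + m - (Fin.rev s : ℕ) = N + s + 1 := by rw [Fin.val_rev]; omega
    have e2 : m - 1 - (Fin.rev s : ℕ) = s := by rw [Fin.val_rev]; omega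
    have e3 : ∀ e : ℕ → ℕ → K, (leadingBlock e (N + m - (Fin.rev s : ℕ))).det
        = (leadingBlock e (N + s + 1)).det := fun e => by rw [e1]
    simp only [Matrix.of_apply, Matrix.submatrix_apply, Fin.revPerm_apply, id, e2, e3]
    rw [← pow_mul_det_leadingBlock hk, mul_div_assoc]
  have h3 : (Matrix.of fun s k : Fin m =>
          (∏ i ∈ Finset.univ.erase k, (1 - C (a i) * X)).coeff (s : ℕ)) =
      (Matrix.of fun j k : Fin m =>
        (∏ i ∈ Finset.univ.erase k, (X - C (a i))).coeff (j : ℕ)).submatrix Fin.revPerm id := by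
    ext s k
    have hs := s.2
    simp only [Matrix.of_apply, Matrix.submatrix_apply, Fin.revPerm_apply, id]
    apply coeff_prod_one_sub
    rw [Finset.card_erase_of_mem (Finset.mem_univ k), Finset.card_univ, Fintype.card_fin,
      Fin.val_rev]
    omega
  -- Both `m × m` matrices appear with their rows reversed, so the same sign stands on both sides
  -- and cancels.
  rw [h2, h3, Matrix.det_permute, Matrix.det_permute, det_lagrange_coeff a ha] at h1
  have hsign : ((Equiv.Perm.sign (Fin.revPerm : Equiv.Perm (Fin m)) : ℤ) : K) ≠ 0 := by
    rcases Int.units_eq_one_or (Equiv.Perm.sign (Fin.revPerm : Equiv.Perm (Fin m))) with h | h <;>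
      simp [h]
  have hne : (∏ j : Fin m, ∏ k ∈ Finset.Ioi j, (a j - a k)) ≠ 0 :=
    Finset.prod_ne_zero_iff.2 fun i _ => Finset.prod_ne_zero_iff.2 fun j hj =>
      sub_ne_zero.2 fun h => (Finset.mem_Ioi.1 hj).ne (ha h)
  have hD := h0 (N + m) (by omega) le_rfl
  rw [div_eq_iff hD, eq_comm, div_mul_eq_mul_div, one_mul, div_mul_eq_mul_div, div_eq_iff hne]
  apply mul_left_cancel₀ hsign
  linear_combination h1

end Core

/-! ### Elementary Schur functions: effect of adding `[c]`, homogeneity, growth. -/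

section Schur
open PowerSeries

/-- The generating series `exp (∑_{k ≥ 1} u_k w^k)` of the elementary Schur functions. -/
noncomputable def schurSeries (u : ℕ+ → TSeries) : PowerSeries TSeries :=
  (PowerSeries.exp ℂ).subst (timeSeries u)

theorem hSchur_natCast (u : ℕ+ → TSeries) (j : ℕ) : hSchur u j = coeff j (schurSeries u) := by
  simp [hSchur, schurSeries]

theorem hSchur_of_neg (u : ℕ+ → TSeries) {j : ℤ} (hj : j < 0) : hSchur u j = 0 := by
  simp [hSchur, hj.not_ge]

theorem schurSeries_eq (u : ℕ+ → TSeries) :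
    schurSeries u = (PowerSeries.exp TSeries).subst (timeSeries u) := by
  ext1 n
  rw [schurSeries, coeff_subst' (hasSubst_timeSeries u), coeff_subst' (hasSubst_timeSeries u)]
  refine finsum_congr fun d => ?_
  rw [coeff_exp, coeff_exp, IsScalarTower.algebraMap_apply ℚ ℂ TSeries]
  exact (algebraMap_smul TSeries _ _).symm

theorem constantCoeff_schurSeries (u : ℕ+ → TSeries) : coeff 0 (schurSeries u) = 1 := by
  rw [schurSeries_eq, coeff_subst' (hasSubst_timeSeries u), finsum_eq_single _ 0]
  · simp
  · intro n hn
    simp [timeSeries, hn]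

theorem derivative_schurSeries (u : ℕ+ → TSeries) :
    derivative TSeries (schurSeries u)
      = schurSeries u * derivative TSeries (timeSeries u) := by
  rw [schurSeries_eq, derivative_subst (hasSubst_timeSeries u), derivative_exp]

/-- A first-order linear equation determines coefficient `n+1` from the earlier ones, since `n+1`
can be cancelled. -/
theorem eq_of_derivative_eq_mul {R : Type*} [CommRing R] [NoZeroDivisors R] [CharZero R]
    {f g q : PowerSeries R} (hf : derivative R f = f * q) (hg : derivative R g = g * q)
    (h0 : coeff 0 f = coeff 0 g) : f = g := by
  have := NoZeroDivisors.to_isDomain R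
  ext n
  induction n using Nat.strong_induction_on with
  | _ n ih =>
    rcases n with _ | n
    · exact h0
    · have h1 := congrArg (coeff n) hf
      have h2 := congrArg (coeff n) hg
      rw [coeff_derivative, coeff_mul] at h1 h2
      have h3 : coeff (n + 1) f * ((n : R) + 1) = coeff (n + 1) g * ((n : R) + 1) := by
        rw [h1, h2]
        refine Finset.sum_congr rfl fun x hx => ?_
        have := Finset.HasAntidiagonal.mem_antidiagonal.1 hx
        rw [ih x.1 (by omega)]
      exact mul_right_cancel₀ (Nat.cast_add_one_ne_zero n) h3

/-- The geometric series `1 / (1 - c w)`. -/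
noncomputable def geomSeries (c : ℂ) : PowerSeries TSeries :=
  PowerSeries.mk fun n => MvPowerSeries.C (c ^ n)

/-- Both sides have constant term 1 and the same logarithmic derivative: that of `1/(1 - cw)` is `∑
c^(n+1) w^n`. -/
theorem schurSeries_add_bracket (u : ℕ+ → TSeries) (c : ℂ) :
    schurSeries (u + bracket c) = schurSeries u * geomSeries c := by
  have hts : timeSeries (u + bracket c) = timeSeries u + timeSeries (bracket c) := by
    ext1 n
    simp only [timeSeries, coeff_mk, map_add]
    split_ifs
    · rfl
    · simp
  have hd : ∀ n, coeff n (derivative TSeries (timeSeries (bracket c)))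
      = MvPowerSeries.C (c ^ (n + 1)) := by
    intro n
    rw [coeff_derivative]
    have h1 : ((n : TSeries) + 1) = MvPowerSeries.C ((n : ℂ) + 1) := by simp
    simp only [timeSeries, coeff_mk, Nat.succ_pos, dif_pos, bracket, h1]
    rw [← map_mul]
    congr 1
    have : ((n : ℂ) + 1) ≠ 0 := Nat.cast_add_one_ne_zero n
    simp only [PNat.mk_coe, Nat.cast_add, Nat.cast_one]
    field_simp
  have hg : derivative TSeries (geomSeries c)
      = geomSeries c * derivative TSeries (timeSeries (bracket c)) := by
    ext1 n
    rw [coeff_mul, coeff_derivative]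
    simp only [hd, geomSeries, coeff_mk]
    rw [Finset.sum_congr rfl (g := fun _ => (MvPowerSeries.C (c ^ (n + 1)) : TSeries))]
    · simp [mul_comm]
    · intro x hx
      rw [← map_mul, ← pow_add, ← Finset.HasAntidiagonal.mem_antidiagonal.1 hx, add_assoc]
  have : CharZero TSeries := charZero_of_injective_algebraMap (R := ℂ) MvPowerSeries.C_injective
  refine eq_of_derivative_eq_mul (derivative_schurSeries _) ?_ ?_
  · rw [Derivation.leibniz, hg, derivative_schurSeries, hts, map_add]
    simp only [smul_eq_mul]
    ring
  · rw [constantCoeff_schurSeries, coeff_mul]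
    simp [constantCoeff_schurSeries, geomSeries]

theorem hSchur_add_bracket (u : ℕ+ → TSeries) (c : ℂ) (j : ℤ) :
    hSchur (u + bracket c) j = hSchur u j + c • hSchur (u + bracket c) (j - 1) := by
  rcases lt_or_ge j 0 with hj | hj
  · simp [hSchur_of_neg _ hj, hSchur_of_neg _ (show j - 1 < 0 by omega)]
  lift j to ℕ using hj
  have hgeom : geomSeries c * (1 - C (MvPowerSeries.C c) * X) = 1 := by
    ext1 n
    rw [mul_sub, mul_one, map_sub, mul_left_comm, coeff_C_mul]
    rcases n with _ | n
    · simp [geomSeries]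
    · rw [coeff_succ_mul_X]
      simp [geomSeries, coeff_one, ← map_mul, pow_succ', -map_pow]
  have h1 : schurSeries u = schurSeries (u + bracket c) * (1 - C (MvPowerSeries.C c) * X) := by
    rw [schurSeries_add_bracket, mul_assoc, hgeom, mul_one]
  rw [hSchur_natCast, hSchur_natCast, h1, mul_sub, mul_one, map_sub, mul_left_comm, coeff_C_mul]
  rcases j with _ | j
  · simp [hSchur_of_neg]
  · rw [coeff_succ_mul_X, MvPowerSeries.smul_eq_C_mul]
    push_cast
    rw [add_sub_cancel_right, hSchur_natCast]
    ring

/-- The weight `∑ k α_k` of a monomial `t^α`. -/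
def tWeight (α : ℕ+ →₀ ℕ) : ℕ := α.sum fun k e => k * e

theorem hSchur_tvar_succ (n : ℕ) :
    ((n : ℂ) + 1) • hSchur tvar ((n + 1 : ℕ) : ℤ) = ∑ x ∈ Finset.HasAntidiagonal.antidiagonal n,
      ((x.2 : ℂ) + 1) • (hSchur tvar (x.1 : ℤ) * tvar x.2.succPNat) := by
  have h := congrArg (coeff n) (derivative_schurSeries tvar)
  rw [coeff_derivative, coeff_mul] at h
  have hc : ∀ n : ℕ, ((n : TSeries) + 1) = MvPowerSeries.C ((n : ℂ) + 1) := fun n => by simp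
  rw [hSchur_natCast, MvPowerSeries.smul_eq_C_mul, ← hc, mul_comm, h]
  refine Finset.sum_congr rfl fun x _ => ?_
  rw [hSchur_natCast, MvPowerSeries.smul_eq_C_mul, coeff_derivative, ← hc]
  simp only [timeSeries, coeff_mk, Nat.succ_pos, dif_pos]
  change _ * (tvar x.2.succPNat * _) = _
  ring

/-- `h_n(t)` is homogeneous of weight `n` when `t_k` has weight `k`. Hence a fixed monomial occurs
in only one `h_n(t)`, which starts the growth estimate below. -/
theorem tWeight_of_coeff_hSchur_ne_zero (n : ℕ) (α : ℕ+ →₀ ℕ)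
    (h : MvPowerSeries.coeff α (hSchur tvar n) ≠ 0) : tWeight α = n := by
  induction n using Nat.strong_induction_on generalizing α with
  | _ n ih =>
    rcases n with _ | n
    · rw [hSchur_natCast, constantCoeff_schurSeries, MvPowerSeries.coeff_one] at h
      have : α = 0 := by by_contra h'; simp [h'] at h
      simp [this, tWeight]
    · have h1 : MvPowerSeries.coeff α (((n : ℂ) + 1) • hSchur tvar ((n + 1 : ℕ) : ℤ)) ≠ 0 := by
        rw [MvPowerSeries.coeff_smul]
        exact mul_ne_zero (Nat.cast_add_one_ne_zero n) h
      rw [hSchur_tvar_succ, map_sum] at h1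
      obtain ⟨x, hx, hne⟩ := Finset.exists_ne_zero_of_sum_ne_zero h1
      rw [MvPowerSeries.coeff_smul, tvar, MvPowerSeries.X, MvPowerSeries.coeff_mul_monomial] at hne
      have hle : Finsupp.single x.2.succPNat 1 ≤ α := by
        by_contra h'; simp [h'] at hne
      rw [if_pos hle, mul_one] at hne
      have hx' := Finset.HasAntidiagonal.mem_antidiagonal.1 hx
      have h2 := ih x.1 (by omega) _ (right_ne_zero_of_mul hne)
      obtain ⟨β, rfl⟩ := exists_add_of_le hle
      rw [add_tsub_cancel_left] at h2
      rw [tWeight, Finsupp.sum_add_index' (by simp) (by intros; ring),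
        Finsupp.sum_single_index (by simp)]
      rw [tWeight] at h2
      rw [h2]
      simp only [Nat.succPNat_coe]
      omega

theorem constantCoeff_hSchur_tvar (n : ℕ) :
    MvPowerSeries.constantCoeff (hSchur tvar n) = if n = 0 then 1 else 0 := by
  split_ifs with h
  · subst h
    rw [hSchur_natCast, constantCoeff_schurSeries, map_one]
  · by_contra h'
    have := tWeight_of_coeff_hSchur_ne_zero n 0 h'
    simp [tWeight] at this
    exact h this.symm

variable {ι : Type*} [DecidableEq ι]

theorem tvar_add_sum_insert (b : ι → ℂ) {S : Finset ι} {i : ι} (hi : i ∉ S) :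
    tvar + ∑ k ∈ insert i S, bracket (b k) = (tvar + ∑ k ∈ S, bracket (b k)) + bracket (b i) := by
  rw [Finset.sum_insert hi, add_assoc, add_comm (bracket (b i))]

theorem norm_coeff_hSchur_le (S : Finset ι) (R : ℝ) (hR : 0 ≤ R) (α : ℕ+ →₀ ℕ) :
    ∃ A B : ℝ, 0 ≤ A ∧ 1 ≤ B ∧ ∀ b : ι → ℂ, (∀ i ∈ S, ‖b i‖ ≤ R) → ∀ j : ℕ,
      ‖MvPowerSeries.coeff α (hSchur (tvar + ∑ k ∈ S, bracket (b k)) j)‖ ≤ A * B ^ j := by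
  induction S using Finset.induction_on with
  | empty =>
    refine ⟨‖MvPowerSeries.coeff α (hSchur tvar (tWeight α))‖, 1, norm_nonneg _, le_rfl,
      fun b _ j => ?_⟩
    rw [Finset.sum_empty, add_zero, one_pow, mul_one]
    by_cases h : MvPowerSeries.coeff α (hSchur tvar j) = 0
    · rw [h, norm_zero]; exact norm_nonneg _
    · rw [tWeight_of_coeff_hSchur_ne_zero j α h]
  | insert i S hi ih =>
    obtain ⟨A, B, hA, hB, hAB⟩ := ih
    -- The new base `B'` must satisfy `B^(j+1) + R B'^j ≤ B'^(j+1)`; `B' = 1 + B + R` does.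
    refine ⟨A, 1 + B + R, hA, by linarith, fun b hb j => ?_⟩
    have hb' : ∀ i ∈ S, ‖b i‖ ≤ R := fun k hk => hb k (Finset.mem_insert_of_mem hk)
    have hbi : ‖b i‖ ≤ R := hb i (Finset.mem_insert_self i S)
    rw [tvar_add_sum_insert b hi]
    induction j with
    | zero =>
      rw [hSchur_add_bracket, hSchur_of_neg _ (show ((0 : ℕ) : ℤ) - 1 < 0 by simp), smul_zero,
        add_zero]
      simpa using hAB b hb' 0
    | succ j ihj =>
      rw [hSchur_add_bracket, map_add, MvPowerSeries.coeff_smul]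
      push_cast
      rw [add_sub_cancel_right]
      refine (norm_add_le _ _).trans ?_
      rw [norm_mul]
      have h1 := hAB b hb' (j + 1)
      push_cast at h1
      have h2 : B ^ (j + 1) ≤ (1 + B + R) ^ j * (1 + B) := by
        rw [pow_succ]
        gcongr <;> linarith
      calc _ ≤ A * ((1 + B + R) ^ j * (1 + B)) + R * (A * (1 + B + R) ^ j) := by
            refine add_le_add (h1.trans (by gcongr)) (mul_le_mul hbi ihj (norm_nonneg _) hR)
        _ = A * (1 + B + R) ^ (j + 1) := by ring

theorem continuous_hSchur (S : Finset ι) (j : ℤ) :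
    Continuous fun b : ι → ℂ => hSchur (tvar + ∑ k ∈ S, bracket (b k)) j := by
  rcases lt_or_ge j 0 with hj | hj
  · simp_rw [hSchur_of_neg _ hj]; exact continuous_const
  lift j to ℕ using hj
  induction S using Finset.induction_on generalizing j with
  | empty => simpa using continuous_const
  | insert i S hi ih =>
    simp_rw [tvar_add_sum_insert _ hi]
    induction j with
    | zero =>
      simp_rw [hSchur_add_bracket _ _ ((0 : ℕ) : ℤ),
        hSchur_of_neg _ (show ((0 : ℕ) : ℤ) - 1 < 0 by simp), smul_zero, add_zero]
      exact ih 0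
    | succ j ihj =>
      simp_rw [hSchur_add_bracket _ _ ((j + 1 : ℕ) : ℤ), MvPowerSeries.smul_eq_C_mul]
      refine (ih (j + 1)).add ?_
      push_cast
      simp_rw [add_sub_cancel_right]
      exact ((MvPowerSeries.WithPiTopology.continuous_C).comp (continuous_apply i)).mul ihj

end Schur

/-! ### Moment bounds and Hankel determinants. -/

section Moments

theorem integrable_of_expMoments {W : ℝ → ℂ}
    (hW : ∀ c : ℝ, Integrable (fun x : ℝ => (Real.exp (c * x) : ℂ) * W x)) : Integrable W := by
  simpa using hW 0

/-- One term of the exponential series gives `(R|x|)^n / n! ≤ e^{R|x|} ≤ e^{Rx} + e^{-Rx}`. -/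
theorem norm_pow_mul_le {R : ℝ} (hR : 0 < R) (W : ℝ → ℂ) (n : ℕ) (x : ℝ) :
    ‖(x : ℂ) ^ n * W x‖ ≤ n.factorial / R ^ n *
      (‖(Real.exp (R * x) : ℂ) * W x‖ + ‖(Real.exp (-R * x) : ℂ) * W x‖) := by
  have h1 : (R * |x|) ^ n / n.factorial ≤ Real.exp (R * |x|) :=
    Real.pow_div_factorial_le_exp _ (by positivity) n
  have h2 : Real.exp (R * |x|) ≤ Real.exp (R * x) + Real.exp (-R * x) := by
    rcases abs_cases x with ⟨h, _⟩ | ⟨h, _⟩ <;> rw [h]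
    · linarith [Real.exp_pos (-R * x)]
    · rw [mul_neg, ← neg_mul]
      linarith [Real.exp_pos (R * x)]
  have hf : (0 : ℝ) < n.factorial := by positivity
  have h3 : |x| ^ n ≤ n.factorial / R ^ n * (Real.exp (R * x) + Real.exp (-R * x)) := by
    rw [div_le_iff₀ hf, mul_pow] at h1
    rw [div_mul_eq_mul_div, le_div_iff₀ (by positivity)]
    nlinarith
  have hexp : ∀ y : ℝ, ‖(Real.exp y : ℂ)‖ = Real.exp y := fun y => by
    rw [Complex.norm_real, Real.norm_of_nonneg (Real.exp_pos _).le]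
  simp only [norm_mul, norm_pow, hexp]
  rw [Complex.norm_real, Real.norm_eq_abs, ← add_mul, ← mul_assoc]
  exact mul_le_mul_of_nonneg_right h3 (norm_nonneg _)

variable {W : ℝ → ℂ}

theorem integrable_pow_mul
    (hW : ∀ c : ℝ, Integrable (fun x : ℝ => (Real.exp (c * x) : ℂ) * W x)) (n : ℕ) :
    Integrable fun x : ℝ => (x : ℂ) ^ n * W x := by
  refine Integrable.mono' (((hW 1).norm.add (hW (-1)).norm).const_mul (n.factorial / 1 ^ n : ℝ)) ?_
    (Filter.Eventually.of_forall fun x => norm_pow_mul_le one_pos W n x)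
  exact ((Complex.continuous_ofReal.pow n).aestronglyMeasurable).mul
    (integrable_of_expMoments hW).aestronglyMeasurable

theorem norm_moment_le
    (hW : ∀ c : ℝ, Integrable (fun x : ℝ => (Real.exp (c * x) : ℂ) * W x)) {R : ℝ} (hR : 0 < R) :
    ∃ I : ℝ, 0 ≤ I ∧ ∀ n, ‖moment W n‖ ≤ n.factorial / R ^ n * I := by
  refine ⟨∫ x, (‖(Real.exp (R * x) : ℂ) * W x‖ + ‖(Real.exp (-R * x) : ℂ) * W x‖),
    integral_nonneg fun x => by positivity, fun n => ?_⟩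
  rw [← integral_const_mul]
  exact norm_integral_le_of_norm_le (((hW R).norm.add (hW (-R)).norm).const_mul _)
    (Filter.Eventually.of_forall fun x => norm_pow_mul_le hR W n x)

theorem summable_moment_mul_pow
    (hW : ∀ c : ℝ, Integrable (fun x : ℝ => (Real.exp (c * x) : ℂ) * W x))
    (p : ℕ) {B : ℝ} (hB : 0 ≤ B) :
    Summable fun j : ℕ => ‖moment W (j + p) / (j.factorial : ℂ)‖ * B ^ j := by
  -- Since `(j+p)! ≤ 2^(j+p) j! p!`, the terms are dominated by a multiple of `(2B/R)^j`; this `R`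
  -- is positive and exceeds `2B`.
  set R : ℝ := 4 * B + 1 with hR
  have hR0 : 0 < R := by positivity
  obtain ⟨I, hI, hM⟩ := norm_moment_le hW hR0
  have hq : Summable fun j : ℕ => (2 * B / R) ^ j :=
    summable_geometric_of_lt_one (by positivity) (by rw [div_lt_one hR0]; linarith)
  refine Summable.of_nonneg_of_le (fun j => by positivity) (fun j => ?_)
    (hq.mul_left (I * p.factorial * 2 ^ p / R ^ p))
  have hj : (0 : ℝ) < j.factorial := by positivity
  have hfac : ((j + p).factorial : ℝ) ≤ 2 ^ (j + p) * j.factorial * p.factorial := by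
    rw [← Nat.add_choose_mul_factorial_mul_factorial j p]
    push_cast
    gcongr
    exact_mod_cast Nat.choose_le_two_pow _ _
  rw [norm_div, Complex.norm_natCast]
  calc ‖moment W (j + p)‖ / j.factorial * B ^ j
      ≤ ((2 ^ (j + p) * j.factorial * p.factorial) / R ^ (j + p) * I) / j.factorial * B ^ j := by
        gcongr
        exact (hM _).trans (by gcongr)
    _ = I * p.factorial * 2 ^ p / R ^ p * (2 * B / R) ^ j := by
        rw [div_pow, mul_pow, pow_add, pow_add]
        field_simp

/-- A kernel vector, read as the coefficients of a polynomial `q`, gives `∫ q² w = 0`. Then `w`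
vanishes almost everywhere off the finitely many roots of `q`. -/
theorem det_hankel_ne_zero {w : ℝ → ℝ} (hw : ∀ x, 0 ≤ w x)
    (hint : ∀ n : ℕ, Integrable fun x => x ^ n * w x) (h0 : ¬ w =ᵐ[volume] 0) (n : ℕ) :
    (Matrix.of fun p l : Fin n => ∫ x, x ^ ((l : ℕ) + p) * w x).det ≠ 0 := by
  intro hdet
  obtain ⟨v, hv, hMv⟩ := Matrix.exists_mulVec_eq_zero_iff.2 hdet
  set q : Polynomial ℝ := ∑ l : Fin n, Polynomial.C (v l) * Polynomial.X ^ (l : ℕ) with hq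
  have hqx : ∀ x, q.eval x = ∑ l : Fin n, v l * x ^ (l : ℕ) := fun x => by
    simp [hq, Polynomial.eval_finsetSum]
  have hq0 : q ≠ 0 := by
    intro h
    apply hv
    funext l
    have := congrArg (fun P => Polynomial.coeff P (l : ℕ)) h
    simpa [hq, Polynomial.finsetSum_coeff, Polynomial.coeff_X_pow, Fin.val_inj,
      Finset.sum_ite_eq] using this
  have hexp : ∀ x, q.eval x ^ 2 * w x
      = ∑ p : Fin n, ∑ l : Fin n, v p * v l * (x ^ ((l : ℕ) + p) * w x) := by
    intro x
    rw [hqx, sq, Finset.sum_mul_sum, Finset.sum_mul]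
    refine Finset.sum_congr rfl fun p _ => ?_
    rw [Finset.sum_mul]
    exact Finset.sum_congr rfl fun l _ => by rw [pow_add]; ring
  have hI : Integrable fun x => q.eval x ^ 2 * w x := by
    simp_rw [hexp]
    exact integrable_finsetSum _ fun p _ => integrable_finsetSum _ fun l _ =>
      (hint _).const_mul _
  have hzero : ∫ x, q.eval x ^ 2 * w x = 0 := by
    simp_rw [hexp]
    rw [integral_finsetSum _ fun p _ => integrable_finsetSum _ fun l _ => (hint _).const_mul _]
    refine Finset.sum_eq_zero fun p _ => ?_
    rw [integral_finsetSum _ fun l _ => (hint _).const_mul _]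
    simp_rw [integral_const_mul]
    have := congrFun hMv p
    simp only [Matrix.mulVec, dotProduct, Matrix.of_apply, Pi.zero_apply] at this
    rw [← mul_zero (v p), ← this, Finset.mul_sum]
    exact Finset.sum_congr rfl fun l _ => by ring
  rw [integral_eq_zero_iff_of_nonneg (fun x => mul_nonneg (sq_nonneg _) (hw x)) hI] at hzero
  apply h0
  have hroots : ∀ᵐ x : ℝ, x ∉ (q.roots.toFinset : Set ℝ) :=
    (Finset.countable_toSet _).ae_notMem volume
  filter_upwards [hzero, hroots] with x hx hr
  have hqx0 : q.eval x ≠ 0 := by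
    intro h
    exact hr (by simp [hq0, h])
  simpa [hqx0] using hx

end Moments

/-! ### Products of absolutely summable families. -/

section CoeffSummable

/-- Coefficientwise absolute summability of a family of formal power series. -/
def CoeffSummable {ι : Type*} (f : ι → TSeries) : Prop :=
  ∀ α, Summable fun i => ‖MvPowerSeries.coeff α (f i)‖

theorem CoeffSummable.summable {ι : Type*} {f : ι → TSeries} (hf : CoeffSummable f) :
    Summable f :=
  MvPowerSeries.WithPiTopology.summable_iff_summable_coeff.2 fun α => (hf α).of_norm

theorem CoeffSummable.mul {ι κ : Type*} {f : ι → TSeries} {g : κ → TSeries}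
    (hf : CoeffSummable f) (hg : CoeffSummable g) :
    CoeffSummable fun x : ι × κ => f x.1 * g x.2 := by
  classical
  intro α
  refine Summable.of_nonneg_of_le (fun _ => norm_nonneg _) (fun x => ?_)
    (summable_sum (s := Finset.HasAntidiagonal.antidiagonal α) fun β _ =>
      (hf β.1).mul_of_nonneg (hg β.2) (fun _ => norm_nonneg _) fun _ => norm_nonneg _)
  rw [MvPowerSeries.coeff_mul]
  refine (norm_sum_le _ _).trans (Finset.sum_le_sum fun β _ => ?_)
  rw [norm_mul]

theorem CoeffSummable.hasSum_mul {ι κ : Type*} {f : ι → TSeries} {g : κ → TSeries} {a b : TSeries}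
    (hf : CoeffSummable f) (hg : CoeffSummable g) (ha : HasSum f a) (hb : HasSum g b) :
    HasSum (fun x : ι × κ => f x.1 * g x.2) (a * b) :=
  ha.mul hb (hf.mul hg).summable

theorem CoeffSummable.pi_prod {n : ℕ} {f : Fin n → ℕ → TSeries} (hf : ∀ p, CoeffSummable (f p)) :
    CoeffSummable (fun j : Fin n → ℕ => ∏ p, f p (j p)) ∧
      HasSum (fun j : Fin n → ℕ => ∏ p, f p (j p)) (∏ p, ∑' j, f p j) := by
  induction n with
  | zero =>
    refine ⟨fun α => ?_, ?_⟩
    · exact Summable.of_finite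
    · simp [hasSum_unique]
  | succ n ih =>
    obtain ⟨h1, h2⟩ := ih fun p => hf p.succ
    have h3 := (hf 0).mul h1
    have hfun : (fun j : Fin (n + 1) → ℕ => ∏ p, f p (j p)) ∘ (Fin.consEquiv fun _ => ℕ)
        = fun x : ℕ × (Fin n → ℕ) => f 0 x.1 * ∏ p, f p.succ (x.2 p) := by
      funext x
      simp [Fin.prod_univ_succ, Fin.consEquiv]
    constructor
    · intro α
      rw [← (Fin.consEquiv fun _ => ℕ).summable_iff]
      have := h3 α
      rw [← hfun] at this
      exact this
    · rw [← (Fin.consEquiv fun _ => ℕ).hasSum_iff, hfun, Fin.prod_univ_succ]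
      have h4 := (hf 0).hasSum_mul h1 (hf 0).summable.hasSum h2
      exact h4

end CoeffSummable

/-! ### Reduction of the multiple series to one determinant. -/

section Columns

/-- The terms of the series for the pairing of `M_{j+p} / j!` with the `l`-th shift of `h_j(u)`. -/
noncomputable def colTerm (W : ℝ → ℂ) (u : ℕ+ → TSeries) (l p j : ℕ) : TSeries :=
  (moment W (j + p) / (j.factorial : ℂ)) • hSchur u ((j : ℤ) - l)

/-- The pairing `∑_j M_{j+p} / j! h_{j-l}(u)`. -/
noncomputable def colEntry (W : ℝ → ℂ) (u : ℕ+ → TSeries) (l p : ℕ) : TSeries :=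
  ∑' j, colTerm W u l p j

theorem zhatTerm_eq_sum (W : ℝ → ℂ) (d : ℕ) (u : ℕ+ → TSeries) (j : Fin d → ℕ) :
    zhatTerm W d u j = ∑ σ : Equiv.Perm (Fin d), ∑ τ : Equiv.Perm (Fin d),
      (((Equiv.Perm.sign σ : ℤ) : TSeries) * ((Equiv.Perm.sign τ : ℤ) : TSeries)) *
        ∏ p, colTerm W u (Fin.rev (τ p)) (σ p) (j p) := by
  rw [zhatTerm, ← Matrix.det_transpose, Matrix.det_apply', ← Matrix.det_transpose,
    Matrix.det_apply', MvPowerSeries.smul_eq_C_mul, Finset.sum_div, map_sum, Finset.sum_mul_sum]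
  refine Finset.sum_congr rfl fun σ _ => Finset.sum_congr rfl fun τ _ => ?_
  rw [mul_div_assoc, ← Finset.prod_div_distrib, map_mul, map_prod, map_intCast, mul_mul_mul_comm,
    ← Finset.prod_mul_distrib]
  congr 1
  refine Finset.prod_congr rfl fun p _ => ?_
  rw [colTerm, MvPowerSeries.smul_eq_C_mul, Matrix.transpose_apply, Matrix.transpose_apply,
    Matrix.of_apply, Matrix.of_apply]
  -- With `q` counted from 0, `j - d + q + 1 = j - (d - 1 - q)`: the shift is the reversed column
  -- index.
  congr 2
  have := (τ p).2
  rw [Fin.val_rev]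
  omega

/-- Once both determinants are expanded, the sum over the `j_p` factors. For each `σ` the sum over
`τ` is the same determinant, its row permutation sign being squared away, which accounts for `d!`.
-/
theorem hasSum_zhatTerm {W : ℝ → ℂ} {u : ℕ+ → TSeries}
    (hu : ∀ l p, CoeffSummable (colTerm W u l p)) (d : ℕ) :
    HasSum (zhatTerm W d u) ((d.factorial : TSeries) *
      (((Equiv.Perm.sign (Fin.revPerm : Equiv.Perm (Fin d)) : ℤ) : TSeries) *
        (Matrix.of fun p l : Fin d => colEntry W u l p).det)) := by
  have h1 : HasSum (zhatTerm W d u) (∑ σ : Equiv.Perm (Fin d), ∑ τ : Equiv.Perm (Fin d),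
      (((Equiv.Perm.sign σ : ℤ) : TSeries) * ((Equiv.Perm.sign τ : ℤ) : TSeries)) *
        ∏ p, colEntry W u (Fin.rev (τ p)) (σ p)) := by
    rw [show zhatTerm W d u = _ from funext (zhatTerm_eq_sum W d u)]
    exact hasSum_sum fun σ _ => hasSum_sum fun τ _ => HasSum.mul_left _
      (CoeffSummable.pi_prod fun p => hu (Fin.rev (τ p)) (σ p)).2
  convert h1 using 1
  set G : Matrix (Fin d) (Fin d) TSeries := Matrix.of fun p l => colEntry W u (Fin.rev l) p with hG
  have hGdet : G.det = ((Equiv.Perm.sign (Fin.revPerm : Equiv.Perm (Fin d)) : ℤ) : TSeries) *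
        (Matrix.of fun p l : Fin d => colEntry W u l p).det :=
    (Matrix.det_permute' Fin.revPerm (Matrix.of fun p l : Fin d => colEntry W u l p))
  rw [← hGdet]
  have h2 : ∀ σ : Equiv.Perm (Fin d), ∑ τ : Equiv.Perm (Fin d),
      (((Equiv.Perm.sign σ : ℤ) : TSeries) * ((Equiv.Perm.sign τ : ℤ) : TSeries)) *
        ∏ p, colEntry W u (Fin.rev (τ p)) (σ p) = G.det := by
    intro σ
    have h3 := Matrix.det_permute σ G
    rw [← Matrix.det_transpose (G.submatrix σ id), Matrix.det_apply'] at h3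
    simp_rw [mul_assoc, ← Finset.mul_sum]
    have h4 : ((Equiv.Perm.sign σ : ℤ) : TSeries) * ((Equiv.Perm.sign σ : ℤ) : TSeries) = 1 := by
      rw [← Int.cast_mul, ← Units.val_mul, Int.units_mul_self]; simp
    calc _ = ((Equiv.Perm.sign σ : ℤ) : TSeries) * (((Equiv.Perm.sign σ : ℤ) : TSeries) * G.det) := by
          rw [← h3]; rfl
      _ = G.det := by rw [← mul_assoc, h4, one_mul]
  rw [Finset.sum_congr rfl fun σ _ => h2 σ]
  simp [Fintype.card_perm]

theorem Zhat_eq {W : ℝ → ℂ} {u : ℕ+ → TSeries}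
    (hu : ∀ l p, CoeffSummable (colTerm W u l p)) (Chat : ℕ → ℂ) (d : ℕ) :
    Zhat W Chat d u = MvPowerSeries.C
      (((Equiv.Perm.sign (Fin.revPerm : Equiv.Perm (Fin d)) : ℤ) : ℂ) / Chat d) *
        (Matrix.of fun p l : Fin d => colEntry W u l p).det := by
  rw [Zhat, (hasSum_zhatTerm hu d).tsum_eq, MvPowerSeries.smul_eq_C_mul,
    ← map_natCast (MvPowerSeries.C (σ := ℕ+) (R := ℂ)),
    ← map_intCast (MvPowerSeries.C (σ := ℕ+) (R := ℂ)), ← mul_assoc, ← mul_assoc, ← map_mul,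
    ← map_mul]
  congr 2
  have : (d.factorial : ℂ) ≠ 0 := Nat.cast_ne_zero.2 d.factorial_ne_zero
  field_simp

theorem colTerm_add_bracket (W : ℝ → ℂ) (u : ℕ+ → TSeries) (c : ℂ) (l p j : ℕ) :
    colTerm W (u + bracket c) l p j
      = colTerm W u l p j + MvPowerSeries.C c * colTerm W (u + bracket c) (l + 1) p j := by
  rw [colTerm, hSchur_add_bracket, smul_add, colTerm, colTerm, ← MvPowerSeries.smul_eq_C_mul,
    smul_comm c, sub_sub]
  push_cast
  rfl

theorem colEntry_add_bracket {W : ℝ → ℂ} {u : ℕ+ → TSeries} {c : ℂ}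
    (hu : ∀ l p, CoeffSummable (colTerm W u l p))
    (hu' : ∀ l p, CoeffSummable (colTerm W (u + bracket c) l p)) (l p : ℕ) :
    colEntry W (u + bracket c) l p
      = colEntry W u l p + MvPowerSeries.C c * colEntry W (u + bracket c) (l + 1) p := by
  rw [colEntry, funext (colTerm_add_bracket W u c l p),
    (hu l p).summable.tsum_add ((hu' (l + 1) p).summable.mul_left _),
    (hu' (l + 1) p).summable.tsum_mul_left]
  rfl

variable {ι : Type*} [DecidableEq ι]

theorem norm_coeff_colTerm_le {W : ℝ → ℂ}
    (hW : ∀ c : ℝ, Integrable (fun x : ℝ => (Real.exp (c * x) : ℂ) * W x))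
    (S : Finset ι) (l p : ℕ) {R : ℝ} (hR : 0 ≤ R) (α : ℕ+ →₀ ℕ) :
    ∃ g : ℕ → ℝ, Summable g ∧ ∀ b : ι → ℂ, (∀ i ∈ S, ‖b i‖ ≤ R) → ∀ j,
      ‖MvPowerSeries.coeff α (colTerm W (tvar + ∑ k ∈ S, bracket (b k)) l p j)‖ ≤ g j := by
  obtain ⟨A, B, hA, hB, h⟩ := norm_coeff_hSchur_le S R hR α
  refine ⟨_, (summable_moment_mul_pow hW p (zero_le_one.trans hB)).mul_left A, fun b hb j => ?_⟩
  rw [colTerm, MvPowerSeries.coeff_smul, norm_mul, mul_left_comm]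
  refine mul_le_mul_of_nonneg_left ?_ (norm_nonneg _)
  rcases lt_or_ge j l with hj | hj
  · rw [hSchur_of_neg _ (by omega), map_zero, norm_zero]
    positivity
  · rw [← Nat.cast_sub hj]
    refine (h b hb _).trans ?_
    gcongr
    · omega

theorem coeffSummable_colTerm {W : ℝ → ℂ}
    (hW : ∀ c : ℝ, Integrable (fun x : ℝ => (Real.exp (c * x) : ℂ) * W x))
    (S : Finset ι) (b : ι → ℂ) (l p : ℕ) :
    CoeffSummable (colTerm W (tvar + ∑ k ∈ S, bracket (b k)) l p) := by
  intro α
  obtain ⟨g, hg, h⟩ := norm_coeff_colTerm_le hW S l p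
    (Finset.sum_nonneg fun i (_ : i ∈ S) => norm_nonneg (b i)) α
  exact Summable.of_nonneg_of_le (fun _ => norm_nonneg _)
    (h b fun i hi => Finset.single_le_sum (f := fun i => ‖b i‖) (fun _ _ => norm_nonneg _) hi) hg

theorem coeff_colEntry {W : ℝ → ℂ} {u : ℕ+ → TSeries} {l p : ℕ}
    (hu : CoeffSummable (colTerm W u l p)) (α : ℕ+ →₀ ℕ) :
    MvPowerSeries.coeff α (colEntry W u l p)
      = ∑' j, MvPowerSeries.coeff α (colTerm W u l p j) :=
  (MvPowerSeries.WithPiTopology.hasSum_iff_hasSum_coeff.1 hu.summable.hasSum α).tsum_eq.symm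

theorem continuous_colEntry [Fintype ι] {W : ℝ → ℂ}
    (hW : ∀ c : ℝ, Integrable (fun x : ℝ => (Real.exp (c * x) : ℂ) * W x))
    (S : Finset ι) (l p : ℕ) :
    Continuous fun b : ι → ℂ => colEntry W (tvar + ∑ k ∈ S, bracket (b k)) l p := by
  refine continuous_pi fun α => ?_
  change Continuous fun b : ι → ℂ =>
    MvPowerSeries.coeff α (colEntry W (tvar + ∑ k ∈ S, bracket (b k)) l p)
  simp_rw [fun b : ι → ℂ => coeff_colEntry (coeffSummable_colTerm hW S b l p) α]
  refine continuous_iff_continuousAt.2 fun b₀ => ?_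
  -- Weierstrass test on a ball around 0 containing `b₀`, where the majorant is uniform in `b`.
  have hR : 0 ≤ ‖b₀‖ + 1 := by positivity
  obtain ⟨g, hg, h⟩ := norm_coeff_colTerm_le hW S l p hR α
  refine (continuousOn_tsum (s := Metric.ball 0 (‖b₀‖ + 1)) (fun j => ?_) hg
    fun j b hb => h b (fun i _ => ?_) j).continuousAt (Metric.isOpen_ball.mem_nhds (by simp))
  · refine Continuous.continuousOn ?_
    simp_rw [colTerm, MvPowerSeries.coeff_smul]
    exact continuous_const.mul
      ((MvPowerSeries.WithPiTopology.continuous_coeff ℂ α).comp (continuous_hSchur S _))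
  · exact (norm_le_pi_norm b i).trans (mem_ball_zero_iff.1 hb).le

/-- At `t = 0` only `h_0 = 1` survives, so the series reduces to its term `j = l`. -/
theorem constantCoeff_colEntry_tvar {W : ℝ → ℂ} {l p : ℕ}
    (hu : CoeffSummable (colTerm W tvar l p)) :
    MvPowerSeries.constantCoeff (colEntry W tvar l p) = moment W (l + p) / (l.factorial : ℂ) := by
  have h := coeff_colEntry hu 0
  rw [MvPowerSeries.coeff_zero_eq_constantCoeff_apply] at h
  rw [h, tsum_eq_single l]
  · rw [colTerm, MvPowerSeries.coeff_smul, sub_self]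
    have := constantCoeff_hSchur_tvar 0
    rw [← MvPowerSeries.coeff_zero_eq_constantCoeff_apply] at this
    simp only [Nat.cast_zero] at this
    rw [this]; simp
  · intro j hj
    rw [colTerm, MvPowerSeries.coeff_smul]
    rcases lt_or_ge j l with hjl | hjl
    · rw [hSchur_of_neg _ (by omega), map_zero, mul_zero]
    · have := constantCoeff_hSchur_tvar (j - l)
      rw [← MvPowerSeries.coeff_zero_eq_constantCoeff_apply, if_neg (by omega),
        Nat.cast_sub hjl] at this
      rw [this, mul_zero]

end Columns

/-! ### Nonvanishing and the determinantal formula. -/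

theorem constantCoeff_Zhat_tvar_ne_zero {w : ℝ → ℝ} (hw : ∀ x, 0 ≤ w x)
    (hW : ∀ c : ℝ, Integrable (fun x : ℝ => (Real.exp (c * x) : ℂ) * (w x : ℂ)))
    (h0 : ¬ (fun x => (w x : ℂ)) =ᵐ[volume] 0) {Chat : ℕ → ℂ} (hChat : ∀ n, Chat n ≠ 0) (n : ℕ) :
    MvPowerSeries.constantCoeff (Zhat (fun x => (w x : ℂ)) Chat n tvar) ≠ 0 := by
  have hu : ∀ l p, CoeffSummable (colTerm (fun x => (w x : ℂ)) tvar l p) := fun l p => by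
    simpa using coeffSummable_colTerm hW (∅ : Finset ℕ) 0 l p
  rw [Zhat_eq hu, map_mul, MvPowerSeries.constantCoeff_C, RingHom.map_det]
  refine mul_ne_zero (div_ne_zero ?_ (hChat n)) ?_
  · exact Int.cast_ne_zero.2 (Units.ne_zero _)
  have hint : ∀ k : ℕ, Integrable fun x => x ^ k * w x := fun k => by
    have := (integrable_pow_mul hW k).re
    refine this.congr (Filter.Eventually.of_forall fun x => ?_)
    change (((x : ℂ) ^ k * (w x : ℂ))).re = _
    rw [← Complex.ofReal_pow, ← Complex.ofReal_mul, Complex.ofReal_re]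
  have hmom : ∀ k, moment (fun x => (w x : ℂ)) k = ((∫ x, x ^ k * w x : ℝ) : ℂ) := fun k => by
    rw [moment, ← integral_complex_ofReal]
    simp
  -- The factor `1/l!` depends only on the column and leaves a Hankel matrix of real moments.
  have hmat : (MvPowerSeries.constantCoeff (σ := ℕ+) (R := ℂ)).mapMatrix
      (Matrix.of fun p l : Fin n => colEntry (fun x => (w x : ℂ)) tvar l p)
      = Matrix.of fun p l : Fin n => (1 / ((l : ℕ).factorial : ℂ)) *
        (Complex.ofRealHom.mapMatrix
          (Matrix.of fun p l : Fin n => ∫ x, x ^ ((l : ℕ) + p) * w x)) p l := by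
    ext p l
    rw [RingHom.mapMatrix_apply, Matrix.map_apply, Matrix.of_apply,
      constantCoeff_colEntry_tvar (hu l p), hmom, Matrix.of_apply, RingHom.mapMatrix_apply,
      Matrix.map_apply, Matrix.of_apply, Complex.ofRealHom_eq_coe]
    ring
  rw [hmat, Matrix.det_mul_row, ← RingHom.map_det]
  refine mul_ne_zero (Finset.prod_ne_zero_iff.2 fun l _ => one_div_ne_zero
    (Nat.cast_ne_zero.2 (Nat.factorial_ne_zero _))) ?_
  rw [Complex.ofRealHom_eq_coe, Complex.ofReal_ne_zero]
  refine det_hankel_ne_zero hw hint (fun h => h0 ?_) n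
  filter_upwards [h] with x hx
  simp [hx]

theorem algebraMap_complex_TField (c : ℂ) :
    algebraMap ℂ TField c = algebraMap TSeries TField (MvPowerSeries.C c) :=
  IsScalarTower.algebraMap_apply ℂ TSeries TField c

theorem algebraMap_det_colEntry (W : ℝ → ℂ) (u : ℕ+ → TSeries) (n : ℕ) :
    algebraMap TSeries TField (Matrix.of fun p l : Fin n => colEntry W u l p).det
      = (leadingBlock (fun l p => algebraMap TSeries TField (colEntry W u l p)) n).det := by
  rw [RingHom.map_det]
  rfl

theorem ratio_Zhat {W : ℝ → ℂ} {u u' : ℕ+ → TSeries}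
    (hu : ∀ l p, CoeffSummable (colTerm W u l p)) (hu' : ∀ l p, CoeffSummable (colTerm W u' l p))
    {Chat : ℕ → ℂ} (hChat : ∀ n, Chat n ≠ 0) (n : ℕ) :
    ratio (Zhat W Chat n u') (Zhat W Chat n u)
      = (leadingBlock (fun l p => algebraMap TSeries TField (colEntry W u' l p)) n).det /
        (leadingBlock (fun l p => algebraMap TSeries TField (colEntry W u l p)) n).det := by
  rw [ratio, Zhat_eq hu, Zhat_eq hu', map_mul, map_mul, algebraMap_det_colEntry,
    algebraMap_det_colEntry]
  refine mul_div_mul_left _ _ ?_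
  rw [← algebraMap_complex_TField]
  refine (map_ne_zero _).2 (div_ne_zero ?_ (hChat n))
  exact Int.cast_ne_zero.2 (Units.ne_zero _)

theorem ratio_Zhat_eq_det {W : ℝ → ℂ}
    (hW : ∀ c : ℝ, Integrable (fun x : ℝ => (Real.exp (c * x) : ℂ) * W x))
    {Chat : ℕ → ℂ} (hChat : ∀ n, Chat n ≠ 0) (N m : ℕ) (hm : 1 ≤ m)
    (h0 : ∀ n, N + 1 ≤ n → n ≤ N + m → Zhat W Chat n tvar ≠ 0)
    (a : Fin m → ℂ) (ha : Function.Injective a) :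
    ratio (Zhat W Chat (N + m) (tvar + ∑ i, bracket (a i))) (Zhat W Chat (N + m) tvar)
      = 1 / algebraMap ℂ TField (vdm a) *
        (Matrix.of fun j k : Fin m =>
          algebraMap ℂ TField (a k ^ (m - 1 - (j : ℕ))) *
            ratio (Zhat W Chat (N + m - (j : ℕ)) (tvar + bracket (a k)))
              (Zhat W Chat (N + m - (j : ℕ)) tvar)).det := by
  have hS := fun (S : Finset (Fin m)) (l p : ℕ) => coeffSummable_colTerm hW S a l p
  have ht : ∀ l p, CoeffSummable (colTerm W tvar l p) := fun l p => by simpa using hS ∅ l p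
  have hk : ∀ k l p, CoeffSummable (colTerm W (tvar + bracket (a k)) l p) := fun k l p => by
    simpa using hS {k} l p
  have key := det_leadingBlock_ratio N hm (fun i => algebraMap ℂ TField (a i))
    ((algebraMap ℂ TField).injective.comp ha)
    (fun S l p => algebraMap TSeries TField (colEntry W (tvar + ∑ k ∈ S, bracket (a k)) l p)) ?_ ?_
  · rw [ratio_Zhat ht (hS Finset.univ) hChat, vdm]
    simp only [ratio_Zhat ht (hk _) hChat, map_prod, map_sub, map_pow]
    simpa only [Finset.sum_empty, add_zero, Finset.sum_singleton] using key
  · intro S i hi l p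
    have hins := hS (insert i S)
    rw [tvar_add_sum_insert a hi] at hins ⊢
    rw [colEntry_add_bracket (hS S) hins, map_add, map_mul, algebraMap_complex_TField]
  · intro n hn hn'
    simp only [Finset.sum_empty, add_zero]
    rw [← algebraMap_det_colEntry]
    intro h
    apply h0 n hn hn'
    rw [Zhat_eq ht, (IsFractionRing.injective TSeries TField) (h.trans (map_zero _).symm), mul_zero]

theorem mainTheorem3
    (W : ℝ → ℂ)
    (hW : ∀ c : ℝ, Integrable (fun x : ℝ => (Real.exp (c * x) : ℂ) * W x))
    (Chat : ℕ → ℂ) (hChat : ∀ n, Chat n ≠ 0) :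
    -- all the series `Ẑ_n(t + [b_1] + … + [b_r])` (with `r = 0`: `Ẑ_n(t)`) converge,
    -- and depend continuously on `b_1, …, b_r`
    (∀ (n r : ℕ) (b : Fin r → ℂ), Summable (zhatTerm W n (tvar + ∑ i, bracket (b i)))) ∧
    (∀ n r : ℕ, Continuous fun b : Fin r → ℂ => Zhat W Chat n (tvar + ∑ i, bracket (b i))) ∧
    -- for a nonnegative weight that is not almost everywhere zero, no `Ẑ_n(t)` vanishes
    ((∃ w : ℝ → ℝ, (∀ x, 0 ≤ w x) ∧ W = fun x => (w x : ℂ)) → ¬ W =ᵐ[volume] 0 →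
      ∀ n : ℕ, Zhat W Chat n tvar ≠ 0) ∧
    -- the determinantal formula, as soon as its denominators are nonzero
    (∀ d m : ℕ, 1 ≤ m → m ≤ d →
      (∀ n, d + 1 - m ≤ n → n ≤ d → Zhat W Chat n tvar ≠ 0) →
      ∀ a : Fin m → ℂ, Function.Injective a →
        ratio (Zhat W Chat d (tvar + ∑ i, bracket (a i))) (Zhat W Chat d tvar)
          = 1 / algebraMap ℂ TField (vdm a) *
            (Matrix.of fun j k : Fin m =>
              algebraMap ℂ TField (a k ^ (m - 1 - (j : ℕ))) *
                ratio (Zhat W Chat (d - (j : ℕ)) (tvar + bracket (a k)))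
                  (Zhat W Chat (d - (j : ℕ)) tvar)).det) := by
  refine ⟨fun n r b => ?_, fun n r => ?_, ?_, ?_⟩
  · exact (hasSum_zhatTerm (coeffSummable_colTerm hW Finset.univ b) n).summable
  · simp_rw [fun b : Fin r → ℂ => Zhat_eq (coeffSummable_colTerm hW Finset.univ b) Chat n]
    refine continuous_const.mul (Continuous.matrix_det ?_)
    exact continuous_matrix fun p l => continuous_colEntry hW Finset.univ l p
  · rintro ⟨w, hw, rfl⟩ h0 n h
    exact constantCoeff_Zhat_tvar_ne_zero hw hW h0 hChat n (by rw [h, map_zero])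
  · intro d m hm hmd h0 a ha
    -- `N = d - m` counts the columns common to `Q` and the matrix at `t`.
    obtain ⟨N, rfl⟩ : ∃ N, d = N + m := ⟨d - m, by omega⟩
    exact ratio_Zhat_eq_det hW hChat N m hm (fun n hn hn' => h0 n (by omega) hn') a ha
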